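/- **Theorem (Convergence of cIGN in the edge weight continuous model).** *Basis operators.* Let $\ell,m\ge 0$ and let $\gamma$ be a partition of $[\ell+m]$, where $1,\dots,\ell$ are called input axes and $\ell+1,\dots,\ell+m$ output axes. The operator $T_\gamma$ maps bounded measurable functions $X:[0,1]^\ell\to\mathbb R$ to functions on $[0,1]^m$: if $v\in[0,1]^m$ has $v_i=v_j$ whenever $\ell+i,\ell+j$ lie in a common block of $\gamma$, then $$T_\gamma(X)(v)=\int_{[0,1]^{S_1}} X(a_1,\dots,a_\ell)\,dt,$$ where $S_1$ is the set of blocks of $\gamma$ that contain only input axes, $a_i=v_j$ if the input axis $i$ lies in a common block with the output axis $\ell+j$, and $a_i=t_B$ if $i$ lies in $B\in S_1$; for all other $v$, $T_\gamma(X)(v)=0$. *Networks.* A layer from $\mathbb R^{[0,1]^\ell\times d}$ to $\mathbb R^{[0,1]^m\times e}$ has the form $$L(X)_o=\sum_{\gamma}\sum_{c=1}^{d}c_{\gamma,o,c}\,T_\gamma(X_c)+\sum_{\beta}b_{\beta,o}\,\mathbf 1_\beta ,\qquad o=1,\dots,e,$$ where $\gamma$ runs over the partitions of $[\ell+m]$,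 $\beta$ over the partitions of $[m]$, and $\mathbf 1_\beta(v)=1$ if $v$ is constant on the blocks of $\beta$ and $0$ otherwise; the $c_{\gamma,o,c}\in\mathbb R$ are the filter coefficients and the bias $b$ may be zero (purely linear layers). A continuous IGN is a map $$\Phi_c=h\circ L^{(T)}\circ\sigma_{T-1}\circ\cdots\circ\sigma_1\circ L^{(1)},\qquad T\ge1,$$ from $\mathbb R^{[0,1]^2\times(1+d)}$ to $\mathbb R^{[0,1]^m\times e}$, where $L^{(1)},\dots,L^{(T)},h$ are layers with arbitrary intermediate tensor orders and channel numbers and the $\sigma_t:\mathbb R\to\mathbb R$ act entrywise. For $m=0$ the layer $h$ is invariant and the output is a vector in $\mathbb R^e$, with its Euclidean norm as $L_2$ norm. *Assumptions.* Let $d,m,e\ge 0$ and let $\Phi_c$ be such a network, with all filter coefficients bounded in absolute value by $A_2$ and all activations satisfying $|\sigma_t(x)-\sigma_t(y)|\le|x-y|$ and $\sigma_t(0)=0$. Let $W:[0,1]^2\to[0,1]$ be symmetric and measurable with $|W(u_2,v_2)-W(u_1,v_1)|\le A_1(|u_2-u_1|+|v_2-v_1|)$, and let $X:[0,1]\to\mathbb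 R^d$ satisfy $\|X(u)-X(v)\|\le A_3|u-v|$. The input $[W,\mathrm{Diag}(X)]$ is the function on $[0,1]^2$ with first channel $W(u,v)$ and remaining channels $X(u)\,\mathrm I_{u=v}$. *Sampling.* For $u_1\le\dots\le u_n$ in $[0,1]$ put $u_{n+1}=1$, $I_i=(u_i,u_{i+1}]$, and $$W_u(x,y)=\sum_{i,j}W(u_i,u_j)\,\mathrm I(x\in I_i)\,\mathrm I(y\in I_j),\qquad X_u(x)=\sum_i X(u_i)\,\mathrm I(x\in I_i).$$ Let $W_n,X_n$ be these functions for the fixed grid $u_i=\frac{i-1}{n}$, and $\widetilde{W_n},\widetilde{X_n}$ those for $u_i$ the $i$-th smallest of $n$ i.i.d. uniform points of $[0,1]$. *Conclusion.* As $n\to\infty$, 1. $\|\Phi_c([W,\mathrm{Diag}(X)])-\Phi_c([W_n,\mathrm{Diag}(X_n)])\|_{L_2}\to 0$; 2. $\|\Phi_c([W,\mathrm{Diag}(X)])-\Phi_c([\widetilde{W_n},\mathrm{Diag}(\widetilde{X_n})])\|_{L_2}\to 0$ in probability. Both hold as well if $[0,u_1]$ is added to the first interval $I_1$, so that $I_1,\dots,I_n$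 cover $[0,1]$. -/

import Mathlib

open MeasureTheory ProbabilityTheory Filter Topology
open scoped ENNReal

noncomputable section

namespace CIGN

/-- The unit interval `[0,1]`; it carries Lebesgue (probability) measure `volume`. -/
abbrev I : Type := unitInterval

/-- A continuous tensor of order `k` with `d` channels, i.e. an element of `ℝ^{[0,1]^k × d}`:
a genuine function on `[0,1]^k`, defined at every point (values on diagonals matter). -/
abbrev Tensor (k d : ℕ) : Type := (Fin k → I) → Fin d → ℝ

/-- The `L²` norm on `[0,1]^k` of a `d`-channel tensor, the channels carrying the Euclidean norm.
For `k = 0` the domain is a single point of mass one and this is the Euclidean norm of a vector. -/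
def l2Norm {k d : ℕ} (F : Tensor k d) : ℝ≥0∞ :=
  eLpNorm (fun v => (WithLp.toLp 2 (F v) : EuclideanSpace ℝ (Fin d))) 2 volume

/-! ### Linear equivariant operators -/

/-- Partitions of the `ℓ` input axes together with the `m` output axes, that is, of `[ℓ + m]`.
`Sum.inl i` is the `i`-th input axis, `Sum.inr j` the `j`-th output axis. -/
abbrev AxisPartition (ℓ m : ℕ) : Type :=
  Finpartition (Finset.univ : Finset (Fin ℓ ⊕ Fin m))

namespace AxisPartition

variable {ℓ m : ℕ}

/-- The blocks that consist of input axes only: the axes that are averaged over. -/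
def inputBlocks (γ : AxisPartition ℓ m) : Finset (Finset (Fin ℓ ⊕ Fin m)) :=
  γ.parts.filter fun B => ∀ j : Fin m, Sum.inr j ∉ B

/-- An output index `v` has the equivalence pattern of `γ`: output axes in a common block carry
equal values. -/
def Matches (γ : AxisPartition ℓ m) (v : Fin m → I) : Prop :=
  ∀ i j : Fin m, γ.part (Sum.inr i) = γ.part (Sum.inr j) → v i = v j

open Classical in
/-- The input index determined by `γ`, by an output index `v` and by the values `t` of the axes that
are averaged over: an input axis that shares its block with an output axis `j` takes the value
`v j` (independent of the choice of `j` if `γ.Matches v`), any other input axis takes the value of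
`t` at its block. -/
def inputIndex (γ : AxisPartition ℓ m) (v : Fin m → I) (t : γ.inputBlocks → I) (i : Fin ℓ) : I :=
  if h : ∃ j : Fin m, Sum.inr j ∈ γ.part (Sum.inl i) then v h.choose
  else t ⟨γ.part (Sum.inl i), Finset.mem_filter.2
    ⟨γ.part_mem.2 (Finset.mem_univ _), fun j hj => h ⟨j, hj⟩⟩⟩

open Classical in
/-- The basis operator `T_γ : ℝ^{[0,1]^ℓ} → ℝ^{[0,1]^m}`: select the slice of the input given by `γ`,
average it over the input-only blocks, align the result with the output axes, replicate it along
the output-only blocks, and put `0` at the output indices that do not have the pattern of `γ`. -/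
def op (γ : AxisPartition ℓ m) (X : (Fin ℓ → I) → ℝ) (v : Fin m → I) : ℝ :=
  if γ.Matches v then ∫ t : γ.inputBlocks → I, X (γ.inputIndex v t) else 0

end AxisPartition

/-! ### Continuous invariant graph networks -/

/-- A linear equivariant layer from `ℓ`-tensors with `d` channels to `m`-tensors with `e` channels:
filter coefficients for the basis operators, one family for each pair of an output and an input
channel, and an (optional) equivariant bias, a combination of the constant `m`-tensors
`T_β 1` for `β` a partition of the output axes (`bias = 0` gives the purely linear layers). -/
structure Layer (ℓ d m e : ℕ) where
  coeff : AxisPartition ℓ m → Fin e → Fin d → ℝ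
  bias : AxisPartition 0 m → Fin e → ℝ

namespace Layer

variable {ℓ d m e : ℕ}

def eval (L : Layer ℓ d m e) (X : Tensor ℓ d) : Tensor m e := fun v o =>
  (∑ γ : AxisPartition ℓ m, ∑ c : Fin d, L.coeff γ o c * γ.op (fun u => X u c) v) +
    ∑ β : AxisPartition 0 m, L.bias β o * β.op (fun _ => 1) v

/-- The filter coefficients are bounded by `A`. -/
def FilterBound (L : Layer ℓ d m e) (A : ℝ) : Prop :=
  ∀ γ o c, |L.coeff γ o c| ≤ A

end Layer

/-- `L^{(T)} ∘ σ ∘ ⋯ ∘ σ ∘ L^{(1)}` with `T ≥ 1`, from `ℓ`-tensors with `d` channels to `m`-tensors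
with `e` channels; intermediate orders and channel numbers are arbitrary. -/
inductive Body : ℕ → ℕ → ℕ → ℕ → Type
  | last {ℓ d m e : ℕ} (L : Layer ℓ d m e) : Body ℓ d m e
  | step {ℓ d ℓ' d' m e : ℕ} (L : Layer ℓ d ℓ' d') (σ : ℝ → ℝ) (rest : Body ℓ' d' m e) :
      Body ℓ d m e

namespace Body

/-- The activations act entrywise. -/
def eval : {ℓ d m e : ℕ} → Body ℓ d m e → Tensor ℓ d → Tensor m e
  | _, _, _, _, last L, X => L.eval X
  | _, _, _, _, step L σ rest, X => rest.eval fun v c => σ (L.eval X v c)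

def FilterBound (A : ℝ) : {ℓ d m e : ℕ} → Body ℓ d m e → Prop
  | _, _, _, _, last L => L.FilterBound A
  | _, _, _, _, step L _ rest => L.FilterBound A ∧ rest.FilterBound A

/-- All activations are normalized Lipschitz. -/
def NormalizedLipschitz : {ℓ d m e : ℕ} → Body ℓ d m e → Prop
  | _, _, _, _, last _ => True
  | _, _, _, _, step _ σ rest =>
      ((∀ x y, |σ x - σ y| ≤ |x - y|) ∧ σ 0 = 0) ∧ rest.NormalizedLipschitz

end Body

/-- A continuous IGN `Φ_c = h ∘ L^{(T)} ∘ σ ∘ ⋯ ∘ σ ∘ L^{(1)}` with input in `ℝ^{[0,1]^2 × d}` and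
output in `ℝ^{[0,1]^m × e}`. For `m = 0` the layer `h` is invariant and the output is a vector in
`ℝ^e`; `m > 0` gives the equivariant networks. -/
structure Network (d m e : ℕ) where
  {midOrder midChannels : ℕ}
  body : Body 2 d midOrder midChannels
  head : Layer midOrder midChannels m e

namespace Network

variable {d m e : ℕ}

def eval (Φ : Network d m e) (X : Tensor 2 d) : Tensor m e := Φ.head.eval (Φ.body.eval X)

def FilterBound (Φ : Network d m e) (A : ℝ) : Prop :=
  Φ.body.FilterBound A ∧ Φ.head.FilterBound A

def NormalizedLipschitz (Φ : Network d m e) : Prop := Φ.body.NormalizedLipschitz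

end Network

/-! ### Graphons, signals and sampling -/

structure Graphon where
  toFun : I → I → ℝ
  measurable' : Measurable (Function.uncurry toFun)
  symm' : ∀ u v, toFun u v = toFun v u
  mem_Icc' : ∀ u v, toFun u v ∈ Set.Icc (0 : ℝ) 1

/-- The network input `[W, Diag(X)]`: channel `0` is `W`, the others are `Diag(X)`. -/
def inputTensor {d : ℕ} (W : I → I → ℝ) (X : I → EuclideanSpace ℝ (Fin d)) : Tensor 2 (d + 1) :=
  open Classical in
  fun v => Fin.cons (W (v 0) (v 1)) fun c => if v 0 = v 1 then X (v 0) c else 0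

/-- The `i`-th interval `(u_i, u_{i+1}]` of the points `u_1 ≤ ⋯ ≤ u_n`, with `u_{n+1} = 1`
(`i` is counted from `0` here). If `full` holds, the points to the left of `u_1`
and `u_1` itself are added to the first interval, so that the intervals cover `[0,1]`;
otherwise they belong to no interval. -/
def block (full : Bool) {n : ℕ} (u : Fin n → I) (i : Fin n) : Set I :=
  {x | (u i < x ∨ (full = true ∧ i.val = 0)) ∧ ∀ h : i.val + 1 < n, x ≤ u ⟨i.val + 1, h⟩}

/-- The piecewise-constant function on `[0,1]²` with value `W(u_i, u_j)` on `I_i × I_j`. -/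
def liftGraphon (full : Bool) {n : ℕ} (W : I → I → ℝ) (u : Fin n → I) : I → I → ℝ :=
  fun x y => ∑ i, ∑ j, W (u i) (u j) *
    ((block full u i).indicator (fun _ => 1) x * (block full u j).indicator (fun _ => 1) y)

/-- The piecewise-constant signal on `[0,1]` with value `X(u_i)` on `I_i`. -/
def liftSignal (full : Bool) {n d : ℕ} (X : I → EuclideanSpace ℝ (Fin d)) (u : Fin n → I) :
    I → EuclideanSpace ℝ (Fin d) :=
  fun x => ∑ i, (block full u i).indicator (fun _ => (1 : ℝ)) x • X (u i)

/-- The fixed grid `u_i = (i - 1) / n`, `i = 1, …, n` (indexed from `0` here). -/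
def fixedGrid (n : ℕ) (i : Fin n) : I :=
  ⟨(i : ℝ) / n, by positivity, div_le_one_of_le₀ (by exact_mod_cast i.2.le) (by positivity)⟩

/-- The points `x_1, …, x_n` in increasing order. -/
def sorted {n : ℕ} (x : Fin n → I) : Fin n → I := x ∘ Tuple.sort x

/-- `‖Φ_c([W, Diag(X)]) - Φ_c([W_u, Diag(X_u)])‖_{L²}`, where `W_u`, `X_u` are the
piecewise-constant lifts of the samples of `W`, `X` at the points `u`. -/
def error (full : Bool) {d m e n : ℕ} (Φ : Network (d + 1) m e) (W : Graphon)
    (X : I → EuclideanSpace ℝ (Fin d)) (u : Fin n → I) : ℝ≥0∞ :=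
  l2Norm (Φ.eval (inputTensor W.toFun X) -
    Φ.eval (inputTensor (liftGraphon full W.toFun u) (liftSignal full X u)))

end CIGN

end

/-!
# Convergence of invariant graph networks on sampled graphons

The argument is qualitative and extracts no rate: it rests on the continuity of `W`, `X` and the
activations, and on the fact that activations do not increase absolute values.

Plain `L²` convergence is not preserved by the basis operators, since these read off values on
diagonals, which are null sets. What is preserved is `BoundedConv`: uniform boundedness together
with pointwise convergence at every index whose coordinates are all positive. The exceptional set is
described coordinate by coordinate, and a coordinate of an input index of `T_γ` is either a
coordinate of the output index or an integration variable, which is almost surely positive. So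
dominated convergence shows that `T_γ` preserves this mode of convergence
(`AxisPartition.boundedConv_op`), hence so do layers and networks
(`Network.boundedConv_eval`); dominated convergence once more turns it into `L²` convergence of the
outputs (`tendsto_l2Norm_sub`).

The sampled inputs converge in this sense whenever the sample points become fine: every `x > 0` then
eventually lies in the block of a sample point close to it, on the diagonal as well as off it
(`boundedConv_inputTensor`). By contradiction, the error is below `ε` for all samples that are
`δ`-fine (`exists_forall_fineBelow_error_lt`). The fixed grid is `δ`-fine as soon as `n > 1 / δ`,
and `n` independent uniform points are `δ`-fine unless they miss one of finitely many cells of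
positive measure, an event whose probability decays geometrically
(`tendsto_measure_not_fineBelow`).
-/

namespace CIGN

/-! ### Bounded convergence away from the coordinate hyperplanes -/

/-- The mode of convergence that networks preserve: measurability, one common bound, and pointwise
convergence at every index all of whose coordinates are positive. The exceptional set is null on
`[0,1]^k` and on each of its diagonals, because it is described coordinate by coordinate. -/
structure BoundedConv {k : ℕ} (f : ℕ → (Fin k → I) → ℝ) (g : (Fin k → I) → ℝ) : Prop where
  measurable : ∀ n, Measurable (f n)
  measurable_lim : Measurable g
  bounded : ∃ C : ℝ, (∀ n v, |f n v| ≤ C) ∧ ∀ v, |g v| ≤ C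
  tendsto : ∀ v : Fin k → I, (∀ i, 0 < v i) → Tendsto (fun n => f n v) atTop (𝓝 (g v))

theorem ae_forall_pos (ι : Type*) [Fintype ι] : ∀ᵐ t : ι → I, ∀ i, 0 < t i := by
  refine ae_all_iff.2 fun i => ?_
  have h : ∀ᵐ x : I, 0 < x := by
    filter_upwards [compl_mem_ae_iff.2 (measure_singleton (0 : I))] with x hx
    exact pos_iff_ne_zero.2 hx
  exact (Measure.quasiMeasurePreserving_eval (fun _ : ι => (volume : Measure I)) i).ae h

namespace BoundedConv

variable {k : ℕ} {f f' : ℕ → (Fin k → I) → ℝ} {g g' : (Fin k → I) → ℝ}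

theorem const (r : ℝ) : BoundedConv (fun _ (_ : Fin k → I) => r) fun _ => r :=
  ⟨fun _ => measurable_const, measurable_const, ⟨|r|, fun _ _ => le_rfl, fun _ => le_rfl⟩,
    fun _ _ => tendsto_const_nhds⟩

theorem add (h : BoundedConv f g) (h' : BoundedConv f' g') :
    BoundedConv (fun n v => f n v + f' n v) fun v => g v + g' v := by
  obtain ⟨C, hf, hg⟩ := h.bounded
  obtain ⟨C', hf', hg'⟩ := h'.bounded
  exact ⟨fun n => (h.measurable n).add (h'.measurable n), h.measurable_lim.add h'.measurable_lim,
    ⟨C + C', fun n v => (abs_add_le _ _).trans (add_le_add (hf n v) (hf' n v)),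
      fun v => (abs_add_le _ _).trans (add_le_add (hg v) (hg' v))⟩,
    fun v hv => (h.tendsto v hv).add (h'.tendsto v hv)⟩

theorem const_mul (r : ℝ) (h : BoundedConv f g) :
    BoundedConv (fun n v => r * f n v) fun v => r * g v := by
  obtain ⟨C, hf, hg⟩ := h.bounded
  refine ⟨fun n => (h.measurable n).const_mul r, h.measurable_lim.const_mul r,
    ⟨|r| * C, fun n v => ?_, fun v => ?_⟩, fun v hv => (h.tendsto v hv).const_mul r⟩
  · rw [abs_mul]; exact mul_le_mul_of_nonneg_left (hf n v) (abs_nonneg r)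
  · rw [abs_mul]; exact mul_le_mul_of_nonneg_left (hg v) (abs_nonneg r)

theorem sum {ι : Type*} (s : Finset ι) {F : ι → ℕ → (Fin k → I) → ℝ} {G : ι → (Fin k → I) → ℝ}
    (h : ∀ i, BoundedConv (F i) (G i)) :
    BoundedConv (fun n v => ∑ i ∈ s, F i n v) fun v => ∑ i ∈ s, G i v := by
  classical
  induction s using Finset.induction_on with
  | empty => simpa using const 0
  | insert i s hi ih => simpa only [Finset.sum_insert hi] using (h i).add ih

theorem comp_lipschitz {σ : ℝ → ℝ} (hσ : ∀ x y, |σ x - σ y| ≤ |x - y|) (h0 : σ 0 = 0)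
    (h : BoundedConv f g) : BoundedConv (fun n v => σ (f n v)) fun v => σ (g v) := by
  have hc : Continuous σ := (LipschitzWith.of_dist_le_mul (K := 1) fun x y => by
    simpa [Real.dist_eq] using hσ x y).continuous
  have hb (x : ℝ) : |σ x| ≤ |x| := by simpa [h0] using hσ x 0
  obtain ⟨C, hf, hg⟩ := h.bounded
  exact ⟨fun n => hc.measurable.comp (h.measurable n), hc.measurable.comp h.measurable_lim,
    ⟨C, fun n v => (hb _).trans (hf n v), fun v => (hb _).trans (hg v)⟩,
    fun v hv => (hc.tendsto _).comp (h.tendsto v hv)⟩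

end BoundedConv

/-! ### The basis operators -/

namespace AxisPartition

variable {ℓ m : ℕ} (γ : AxisPartition ℓ m)

theorem measurable_inputIndex :
    Measurable fun p : (Fin m → I) × (γ.inputBlocks → I) => γ.inputIndex p.1 p.2 := by
  refine measurable_pi_lambda _ fun i => ?_
  unfold inputIndex
  split_ifs with h
  · fun_prop
  · fun_prop

theorem measurableSet_matches : MeasurableSet {v : Fin m → I | γ.Matches v} := by
  simp only [Matches, Set.ofPred_forall]
  exact .iInter fun i => .iInter fun j => .iInter fun _ =>
    measurableSet_eq_fun (measurable_pi_apply i) (measurable_pi_apply j)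

theorem measurable_op {X : (Fin ℓ → I) → ℝ} (hX : Measurable X) : Measurable (γ.op X) := by
  unfold op
  exact Measurable.ite γ.measurableSet_matches
    (hX.comp γ.measurable_inputIndex).stronglyMeasurable.integral_prod_right'.measurable
    measurable_const

theorem abs_op_le {X : (Fin ℓ → I) → ℝ} {C : ℝ} (hX : ∀ u, |X u| ≤ C) (v : Fin m → I) :
    |γ.op X v| ≤ C := by
  have hC : 0 ≤ C := (abs_nonneg _).trans (hX 0)
  unfold op
  split_ifs
  · simpa using norm_integral_le_of_norm_le_const (μ := (volume : Measure (γ.inputBlocks → I)))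
      (f := fun t => X (γ.inputIndex v t)) (ae_of_all _ fun t => hX _)
  · simpa using hC

theorem inputIndex_pos {v : Fin m → I} (hv : ∀ j, 0 < v j) {t : γ.inputBlocks → I}
    (ht : ∀ B, 0 < t B) (i : Fin ℓ) : 0 < γ.inputIndex v t i := by
  unfold inputIndex
  split_ifs
  exacts [hv _, ht _]

/-- The operators `T_γ` preserve bounded convergence: every coordinate of an input index is either
an output coordinate or an integration variable, so dominated convergence applies. -/
theorem boundedConv_op {f : ℕ → (Fin ℓ → I) → ℝ} {g : (Fin ℓ → I) → ℝ} (h : BoundedConv f g) :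
    BoundedConv (fun n => γ.op (f n)) (γ.op g) := by
  obtain ⟨C, hf, hg⟩ := h.bounded
  refine ⟨fun n => γ.measurable_op (h.measurable n), γ.measurable_op h.measurable_lim,
    ⟨C, fun n => γ.abs_op_le (hf n), γ.abs_op_le hg⟩, fun v hv => ?_⟩
  unfold op
  split_ifs
  · refine tendsto_integral_of_dominated_convergence (fun _ => C) (fun n => ?_)
      (integrable_const C) (fun n => ae_of_all _ fun t => hf n _) ?_
    · exact ((h.measurable n).comp
        (γ.measurable_inputIndex.comp measurable_prodMk_left)).aestronglyMeasurable
    · filter_upwards [ae_forall_pos γ.inputBlocks] with t ht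
      exact h.tendsto _ (γ.inputIndex_pos hv ht)
  · exact tendsto_const_nhds

end AxisPartition

/-! ### Networks -/

theorem Layer.boundedConv_eval {ℓ d m e : ℕ} (L : Layer ℓ d m e) {F : ℕ → Tensor ℓ d}
    {G : Tensor ℓ d} (h : ∀ c, BoundedConv (fun n v => F n v c) fun v => G v c) (o : Fin e) :
    BoundedConv (fun n v => L.eval (F n) v o) fun v => L.eval G v o :=
  .add (.sum _ fun γ => .sum _ fun c => .const_mul _ (γ.boundedConv_op (h c)))
    (.sum _ fun β => .const_mul _ (β.boundedConv_op (.const 1)))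

theorem Body.boundedConv_eval {ℓ d m e : ℕ} (N : Body ℓ d m e) (hN : N.NormalizedLipschitz)
    {F : ℕ → Tensor ℓ d} {G : Tensor ℓ d}
    (h : ∀ c, BoundedConv (fun n v => F n v c) fun v => G v c) (o : Fin e) :
    BoundedConv (fun n v => N.eval (F n) v o) fun v => N.eval G v o := by
  induction N with
  | last L => exact L.boundedConv_eval h o
  | step L σ rest ih =>
    exact ih hN.2 (fun c => (L.boundedConv_eval h c).comp_lipschitz hN.1.1 hN.1.2) o

theorem Network.boundedConv_eval {d m e : ℕ} (Φ : Network d m e) (hΦ : Φ.NormalizedLipschitz)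
    {F : ℕ → Tensor 2 d} {G : Tensor 2 d}
    (h : ∀ c, BoundedConv (fun n v => F n v c) fun v => G v c) (o : Fin e) :
    BoundedConv (fun n v => Φ.eval (F n) v o) fun v => Φ.eval G v o :=
  Φ.head.boundedConv_eval (Φ.body.boundedConv_eval hΦ h) o

theorem tendsto_l2Norm_sub {k d : ℕ} {F : ℕ → Tensor k d} {G : Tensor k d}
    (h : ∀ c, BoundedConv (fun n v => F n v c) fun v => G v c) :
    Tendsto (fun n => l2Norm (G - F n)) atTop (𝓝 0) := by
  choose C hF hG using fun c => (h c).bounded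
  let D : ℕ → (Fin k → I) → EuclideanSpace ℝ (Fin d) := fun n v => WithLp.toLp 2 ((G - F n) v)
  have hmeas (n : ℕ) : Measurable (D n) :=
    (WithLp.measurable_toLp 2 _).comp (measurable_pi_lambda _ fun c =>
      (h c).measurable_lim.sub ((h c).measurable n))
  have hbound (n : ℕ) (v : Fin k → I) : ‖D n v‖ ≤ √(∑ c, (2 * C c) ^ 2) := by
    rw [EuclideanSpace.norm_eq]
    refine Real.sqrt_le_sqrt (Finset.sum_le_sum fun c _ => ?_)
    refine pow_le_pow_left₀ (norm_nonneg _) ?_ 2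
    exact (norm_sub_le (G v c) (F n v c)).trans (by
      have := hF c n v; have := hG c v; simp only [Real.norm_eq_abs]; linarith)
  have hlim : ∀ᵐ v : Fin k → I, Tendsto (fun n => ‖D n v‖ₑ ^ (2 : ℝ)) atTop (𝓝 0) := by
    filter_upwards [ae_forall_pos (Fin k)] with v hv
    have hsub : Tendsto (fun n => (G - F n) v) atTop (𝓝 0) := tendsto_pi_nhds.2 fun c => by
      simpa using ((h c).tendsto v hv).const_sub (G v c)
    have hD : Tendsto (fun n => ‖D n v‖ₑ) atTop (𝓝 0) := by
      simpa [D] using (((PiLp.continuous_toLp 2 _).tendsto _).comp hsub).enorm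
    simpa using hD.ennrpow_const 2
  have hint := tendsto_lintegral_of_dominated_convergence
    (fun _ => ENNReal.ofReal √(∑ c, (2 * C c) ^ 2) ^ (2 : ℝ))
    (fun n => (hmeas n).enorm.pow_const _)
    (fun n => ae_of_all _ fun v => ENNReal.rpow_le_rpow
      (by rw [← ofReal_norm]; exact ENNReal.ofReal_le_ofReal (hbound n v)) zero_le_two)
    (by simp) hlim
  have hroot := hint.ennrpow_const (1 / 2)
  simpa [l2Norm, eLpNorm_eq_lintegral_rpow_enorm_toReal, D] using hroot

/-! ### Sampling along a fine set of points -/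

/-- Every `x ≥ δ` has a sample point strictly below it, at distance at most `δ`. This is a property
of the set of sample points, so it is insensitive to sorting. -/
def FineBelow {n : ℕ} (δ : ℝ) (u : Fin n → I) : Prop :=
  ∀ x : I, δ ≤ x → ∃ i, u i < x ∧ (x : ℝ) ≤ u i + δ

theorem FineBelow.sorted {n : ℕ} {δ : ℝ} {u : Fin n → I} (h : FineBelow δ u) :
    FineBelow δ (sorted u) := fun x hx => by
  obtain ⟨i, hi⟩ := h x hx
  exact ⟨(Tuple.sort u).symm i, by simpa [CIGN.sorted] using hi⟩

theorem measurableSet_block (full : Bool) {n : ℕ} (u : Fin n → I) (i : Fin n) :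
    MeasurableSet (block full u i) := by
  have h : block full u i = (Set.Ioi (u i) ∪ {_x | full = true ∧ i.val = 0}) ∩
      ⋂ h : i.val + 1 < n, Set.Iic (u ⟨i.val + 1, h⟩) := by
    ext x
    simp [block]
  rw [h]
  exact .inter (.union measurableSet_Ioi (.const _)) (.iInter fun _ => measurableSet_Iic)

section Lift

variable {full : Bool} {n d : ℕ} {u : Fin n → I} {x y : I} {i j : Fin n}

theorem eq_of_mem_block (hu : Monotone u) (hi : x ∈ block full u i) (hj : x ∈ block full u j) :
    i = j := by
  have key : ∀ {i j : Fin n}, x ∈ block full u i → x ∈ block full u j → ¬ i < j := by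
    intro i j hi hj hij
    have hlt : i.val + 1 < n := lt_of_le_of_lt hij j.2
    have hle : x ≤ u j := (hi.2 hlt).trans (hu (by simpa [Fin.le_def] using hij))
    rcases hj.1 with h | h
    · exact absurd h hle.not_gt
    · have := Fin.lt_def.1 hij
      omega
  exact le_antisymm (not_lt.1 (key hj hi)) (not_lt.1 (key hi hj))

theorem FineBelow.exists_mem_block {δ : ℝ} (hu : Monotone u) (h : FineBelow δ u) (hx : δ ≤ x) :
    ∃ i, x ∈ block full u i ∧ dist (u i) x ≤ δ := by
  obtain ⟨i₀, h₀, h₀'⟩ := h x hx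
  -- the block of `x` is given by the last sample point below `x`
  obtain ⟨i, hi, hmax⟩ := (Finset.univ.filter fun i => u i < x).exists_max_image id
    ⟨i₀, by simpa using h₀⟩
  simp only [Finset.mem_filter, Finset.mem_univ, true_and, id] at hi hmax
  refine ⟨i, ⟨.inl hi, fun hlt => not_lt.1 fun hcon => ?_⟩, ?_⟩
  · have := Fin.le_def.1 (hmax _ hcon)
    simp at this
  · have h1 : (u i₀ : ℝ) ≤ u i := hu (hmax _ h₀)
    have h2 : (u i : ℝ) < x := hi
    rw [Subtype.dist_eq, Real.dist_eq, abs_le]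
    constructor <;> linarith

theorem sum_indicator_block_smul {E : Type*} [AddCommGroup E] [Module ℝ E] (hu : Monotone u)
    (hi : x ∈ block full u i) (f : Fin n → E) :
    ∑ k, (block full u k).indicator (fun _ => (1 : ℝ)) x • f k = f i := by
  rw [Finset.sum_eq_single i (fun k _ hk => ?_) (by simp), Set.indicator_of_mem hi, one_smul]
  rw [Set.indicator_of_notMem fun h => hk (eq_of_mem_block hu h hi), zero_smul]

theorem liftSignal_of_mem (hu : Monotone u) (X : I → EuclideanSpace ℝ (Fin d))
    (hi : x ∈ block full u i) : liftSignal full X u x = X (u i) :=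
  sum_indicator_block_smul hu hi _

theorem liftGraphon_of_mem (hu : Monotone u) (W : I → I → ℝ)
    (hi : x ∈ block full u i) (hj : y ∈ block full u j) :
    liftGraphon full W u x y = W (u i) (u j) := by
  have h (a b : Fin n) : W (u a) (u b) *
      ((block full u a).indicator (fun _ => 1) x * (block full u b).indicator (fun _ => 1) y) =
      (block full u a).indicator (fun _ => (1 : ℝ)) x •
        ((block full u b).indicator (fun _ => (1 : ℝ)) y • W (u a) (u b)) := by
    simp only [smul_eq_mul]; ring
  simp only [liftGraphon, h, ← Finset.smul_sum, sum_indicator_block_smul hu hj,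
    sum_indicator_block_smul hu hi (fun a => W (u a) (u j))]

theorem norm_liftSignal_le (hu : Monotone u) {X : I → EuclideanSpace ℝ (Fin d)} {C : ℝ}
    (hX : ∀ x, ‖X x‖ ≤ C) (x : I) : ‖liftSignal full X u x‖ ≤ C := by
  by_cases h : ∃ i, x ∈ block full u i
  · obtain ⟨i, hi⟩ := h
    rw [liftSignal_of_mem hu X hi]
    exact hX _
  · push Not at h
    simpa [liftSignal, h] using (norm_nonneg _).trans (hX 0)

theorem abs_liftGraphon_le (hu : Monotone u) {W : I → I → ℝ} {C : ℝ}
    (hW : ∀ x y, |W x y| ≤ C) (x y : I) : |liftGraphon full W u x y| ≤ C := by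
  have hC : 0 ≤ C := (abs_nonneg _).trans (hW 0 0)
  by_cases hx : ∃ i, x ∈ block full u i
  · by_cases hy : ∃ j, y ∈ block full u j
    · obtain ⟨i, hi⟩ := hx
      obtain ⟨j, hj⟩ := hy
      rw [liftGraphon_of_mem hu W hi hj]
      exact hW _ _
    · push Not at hy
      simpa [liftGraphon, hy] using hC
  · push Not at hx
    simpa [liftGraphon, hx] using hC

theorem measurable_liftSignal (full : Bool) (X : I → EuclideanSpace ℝ (Fin d)) (u : Fin n → I) :
    Measurable (liftSignal full X u) := by
  unfold liftSignal
  exact Finset.measurable_fun_sum _ fun i _ =>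
    (measurable_const.indicator (measurableSet_block full u i)).smul_const _

theorem measurable_liftGraphon (full : Bool) (W : I → I → ℝ) (u : Fin n → I) :
    Measurable (Function.uncurry (liftGraphon full W u)) := by
  unfold liftGraphon Function.uncurry
  have h (i : Fin n) : Measurable ((block full u i).indicator fun _ => (1 : ℝ)) :=
    measurable_const.indicator (measurableSet_block full u i)
  exact Finset.measurable_fun_sum _ fun i _ => Finset.measurable_fun_sum _ fun j _ =>
    (((h i).comp measurable_fst).mul ((h j).comp measurable_snd)).const_mul _

end Lift

section Limit

variable {full : Bool} {d : ℕ} {N : ℕ → ℕ} {u : ∀ k, Fin (N k) → I} {δ : ℕ → ℝ}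

/-- Around any `x > 0`, the sample point that represents `x` converges to `x`. -/
theorem exists_tendsto_sample (hu : ∀ k, Monotone (u k)) (hfine : ∀ k, FineBelow (δ k) (u k))
    (hδ : Tendsto δ atTop (𝓝 0)) {x : I} (hx : 0 < x) :
    ∃ p : ℕ → I, Tendsto p atTop (𝓝 x) ∧
      ∀ᶠ k in atTop, ∃ i, x ∈ block full (u k) i ∧ p k = u k i := by
  have h (k : ℕ) : ∃ p : I, δ k ≤ x →
      dist p x ≤ δ k ∧ ∃ i, x ∈ block full (u k) i ∧ p = u k i := by
    by_cases hk : δ k ≤ x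
    · obtain ⟨i, hi, hd⟩ := (hfine k).exists_mem_block (full := full) (hu k) hk
      exact ⟨u k i, fun _ => ⟨hd, i, hi, rfl⟩⟩
    · exact ⟨0, fun h => absurd h hk⟩
  choose p hp using h
  have hev : ∀ᶠ k in atTop, δ k ≤ x := hδ.eventually (ge_mem_nhds (by exact_mod_cast hx))
  exact ⟨p, tendsto_iff_dist_tendsto_zero.2 (squeeze_zero' (.of_forall fun _ => dist_nonneg)
    (hev.mono fun k hk => (hp k hk).1) hδ), hev.mono fun k hk => (hp k hk).2⟩

theorem tendsto_liftSignal (hu : ∀ k, Monotone (u k)) (hfine : ∀ k, FineBelow (δ k) (u k))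
    (hδ : Tendsto δ atTop (𝓝 0)) {X : I → EuclideanSpace ℝ (Fin d)} (hX : Continuous X)
    {x : I} (hx : 0 < x) :
    Tendsto (fun k => liftSignal full X (u k) x) atTop (𝓝 (X x)) := by
  obtain ⟨p, hp, hev⟩ := exists_tendsto_sample (full := full) hu hfine hδ hx
  refine ((hX.tendsto x).comp hp).congr' (hev.mono ?_)
  rintro k ⟨i, hi, hpi⟩
  simp [liftSignal_of_mem (hu k) X hi, hpi]

theorem tendsto_liftGraphon (hu : ∀ k, Monotone (u k)) (hfine : ∀ k, FineBelow (δ k) (u k))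
    (hδ : Tendsto δ atTop (𝓝 0)) {W : I → I → ℝ} (hW : Continuous (Function.uncurry W))
    {x y : I} (hx : 0 < x) (hy : 0 < y) :
    Tendsto (fun k => liftGraphon full W (u k) x y) atTop (𝓝 (W x y)) := by
  obtain ⟨p, hp, hpev⟩ := exists_tendsto_sample (full := full) hu hfine hδ hx
  obtain ⟨q, hq, hqev⟩ := exists_tendsto_sample (full := full) hu hfine hδ hy
  refine ((hW.tendsto (x, y)).comp (hp.prodMk_nhds hq)).congr' ?_
  filter_upwards [hpev, hqev]
  rintro k ⟨i, hi, hpi⟩ ⟨j, hj, hqj⟩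
  simp [liftGraphon_of_mem (hu k) W hi hj, hpi, hqj]

theorem boundedConv_inputTensor (hu : ∀ k, Monotone (u k)) (hfine : ∀ k, FineBelow (δ k) (u k))
    (hδ : Tendsto δ atTop (𝓝 0)) {W : I → I → ℝ} (hW : Continuous (Function.uncurry W))
    {X : I → EuclideanSpace ℝ (Fin d)} (hX : Continuous X) (c : Fin (d + 1)) :
    BoundedConv
      (fun k v => inputTensor (liftGraphon full W (u k)) (liftSignal full X (u k)) v c)
      fun v => inputTensor W X v c := by
  have hpair : Measurable fun v : Fin 2 → I => (v 0, v 1) := by fun_prop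
  have hdiag : MeasurableSet {v : Fin 2 → I | v 0 = v 1} :=
    measurableSet_eq_fun (measurable_pi_apply 0) (measurable_pi_apply 1)
  refine Fin.cases ?_ (fun c => ?_) c
  · obtain ⟨C, hC⟩ := isCompact_univ.exists_bound_of_continuousOn hW.continuousOn
    have hC' (x y : I) : |W x y| ≤ C := hC (x, y) trivial
    simp only [inputTensor, Fin.cons_zero]
    have hcomp {V : I → I → ℝ} (hV : Measurable (Function.uncurry V)) :
        Measurable fun v : Fin 2 → I => V (v 0) (v 1) := hV.comp hpair
    exact ⟨fun k => hcomp (measurable_liftGraphon full W (u k)), hcomp hW.measurable,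
      ⟨C, fun k v => abs_liftGraphon_le (hu k) hC' _ _, fun v => hC' _ _⟩,
      fun v hv => tendsto_liftGraphon hu hfine hδ hW (hv 0) (hv 1)⟩
  · obtain ⟨C, hC⟩ := isCompact_univ.exists_bound_of_continuousOn hX.continuousOn
    have hC' (x : I) : ‖X x‖ ≤ C := hC x trivial
    have hC0 : 0 ≤ C := (norm_nonneg _).trans (hC' 0)
    have hcoord : Measurable fun z : EuclideanSpace ℝ (Fin d) => z c := by fun_prop
    simp only [inputTensor, Fin.cons_succ]
    refine ⟨fun k => .ite hdiag (hcoord.comp ((measurable_liftSignal full X (u k)).comp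
      (measurable_pi_apply 0))) measurable_const,
      .ite hdiag (hcoord.comp (hX.measurable.comp (measurable_pi_apply 0))) measurable_const,
      ⟨C, fun k v => ?_, fun v => ?_⟩, fun v hv => ?_⟩
    · split_ifs
      · exact (PiLp.norm_apply_le _ c).trans (norm_liftSignal_le (hu k) hC' _)
      · simpa using hC0
    · split_ifs
      · exact (PiLp.norm_apply_le _ c).trans (hC' _)
      · simpa using hC0
    · split_ifs
      · exact ((show Continuous fun z : EuclideanSpace ℝ (Fin d) => z c by fun_prop).tendsto
          _).comp (tendsto_liftSignal hu hfine hδ hX (hv 0))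
      · exact tendsto_const_nhds

end Limit

/-- The error is small as soon as the sample points are fine, uniformly in their number and
position. -/
theorem exists_forall_fineBelow_error_lt (full : Bool) {d m e : ℕ} (Φ : Network (d + 1) m e)
    (hΦ : Φ.NormalizedLipschitz) (W : Graphon) (hW : Continuous (Function.uncurry W.toFun))
    {X : I → EuclideanSpace ℝ (Fin d)} (hX : Continuous X) {ε : ℝ≥0∞} (hε : 0 < ε) :
    ∃ δ : ℝ, 0 < δ ∧ ∀ (n : ℕ) (u : Fin n → I), Monotone u → FineBelow δ u →
      error full Φ W X u < ε := by
  -- a family of counterexamples would be a sequence of samples along which the error tends to `0`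
  by_contra! hcon
  have hpos (k : ℕ) : (0 : ℝ) < 1 / ((k : ℝ) + 1) := by positivity
  choose N u hu hfine herr using fun k : ℕ => hcon _ (hpos k)
  have hlim : Tendsto (fun k => error full Φ W X (u k)) atTop (𝓝 0) :=
    tendsto_l2Norm_sub (Φ.boundedConv_eval hΦ
      (boundedConv_inputTensor hu hfine tendsto_one_div_add_atTop_nhds_zero_nat hW hX))
  obtain ⟨k, hk⟩ := (hlim.eventually (gt_mem_nhds hε)).exists
  exact (herr k).not_gt hk

/-! ### Fixed and random grids -/

theorem monotone_fixedGrid (n : ℕ) : Monotone (fixedGrid n) := fun i j hij => by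
  rw [← Subtype.coe_le_coe]
  exact div_le_div_of_nonneg_right (by exact_mod_cast hij) (Nat.cast_nonneg n)

theorem fineBelow_fixedGrid {n : ℕ} {δ : ℝ} (hδ : 0 < δ) (hn : 1 / δ < n) :
    FineBelow δ (fixedGrid n) := fun x hx => by
  have hn0 : (0 : ℝ) < n := (one_div_pos.2 hδ).trans hn
  have hxn : 0 < (x : ℝ) * n := mul_pos (hδ.trans_le hx) hn0
  have hc : 0 < ⌈(x : ℝ) * n⌉₊ := Nat.ceil_pos.2 hxn
  have hcn : ⌈(x : ℝ) * n⌉₊ ≤ n := Nat.ceil_le.2 (mul_le_of_le_one_left hn0.le x.2.2)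
  have hlt : ((⌈(x : ℝ) * n⌉₊ - 1 : ℕ) : ℝ) < x * n := Nat.lt_ceil.1 (by omega)
  have hge : (x : ℝ) * n ≤ ((⌈(x : ℝ) * n⌉₊ - 1 : ℕ) : ℝ) + 1 := by
    have := Nat.le_ceil ((x : ℝ) * n)
    rw [Nat.cast_sub hc]; push_cast; linarith
  refine ⟨⟨⌈(x : ℝ) * n⌉₊ - 1, by omega⟩, ?_, ?_⟩
  · rw [← Subtype.coe_lt_coe]
    exact (div_lt_iff₀ hn0).2 hlt
  · have h1 : 1 ≤ δ * n := by
      rw [div_lt_iff₀ hδ] at hn; linarith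
    simp only [fixedGrid]
    rw [div_add' _ _ _ hn0.ne', le_div_iff₀ hn0]
    linarith

/-- The cell `[k/M, (k+1)/M)` of `[0,1]`. -/
def cell (M k : ℕ) : Set I := {y | (k : ℝ) / M ≤ y ∧ (y : ℝ) < (k + 1) / M}

theorem measurableSet_cell (M k : ℕ) : MeasurableSet (cell M k) :=
  .inter (measurableSet_le measurable_const measurable_subtype_coe)
    (measurableSet_lt measurable_subtype_coe measurable_const)

theorem volume_cell_pos {M k : ℕ} (hk : k < M) : 0 < volume (cell M k) := by
  have hM : (0 : ℝ) < M := by exact_mod_cast (Nat.zero_le k).trans_lt hk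
  have himg : Subtype.val '' cell M k = Set.Ico ((k : ℝ) / M) ((k + 1) / M) := by
    ext y
    constructor
    · rintro ⟨y, hy, rfl⟩
      exact hy
    · intro hy
      refine ⟨⟨y, (by positivity : (0 : ℝ) ≤ k / M).trans hy.1, hy.2.le.trans ?_⟩, hy, rfl⟩
      exact (div_le_one hM).2 (by exact_mod_cast hk)
  rw [unitInterval.volume_apply, himg, Real.volume_Ico, ENNReal.ofReal_pos, sub_pos]
  exact div_lt_div_of_pos_right (by linarith) hM

theorem fineBelow_of_forall_cell {n M : ℕ} {δ : ℝ} (hM : 0 < M) (hδ : 2 / M ≤ δ) {u : Fin n → I}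
    (h : ∀ k < M, ∃ i, u i ∈ cell M k) : FineBelow δ u := fun x hx => by
  have hM' : (0 : ℝ) < M := by exact_mod_cast hM
  -- the cell before the one that contains `x`
  have h2 : 2 ≤ (x : ℝ) * M := (div_le_iff₀ hM').1 (hδ.trans hx)
  have hfl : 2 ≤ ⌊(x : ℝ) * M⌋₊ := Nat.le_floor (by exact_mod_cast h2)
  have hflM : ⌊(x : ℝ) * M⌋₊ ≤ M :=
    Nat.floor_le_of_le (mul_le_of_le_one_left hM'.le x.2.2)
  obtain ⟨i, hi1, hi2⟩ := h (⌊(x : ℝ) * M⌋₊ - 1) (by omega)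
  have hcast : ((⌊(x : ℝ) * M⌋₊ - 1 : ℕ) : ℝ) = (⌊(x : ℝ) * M⌋₊ : ℝ) - 1 := by
    rw [Nat.cast_sub (by omega)]; simp
  have hle := Nat.floor_le (by linarith : 0 ≤ (x : ℝ) * M)
  have hlt := Nat.lt_floor_add_one ((x : ℝ) * M)
  rw [hcast, div_le_iff₀ hM'] at hi1
  rw [hcast, lt_div_iff₀ hM'] at hi2
  rw [div_le_iff₀ hM'] at hδ
  refine ⟨i, ?_, ?_⟩
  · rw [← Subtype.coe_lt_coe]
    nlinarith
  · nlinarith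

theorem tendsto_measure_not_fineBelow {Ω : Type*} [MeasurableSpace Ω] (P : Measure Ω)
    [IsProbabilityMeasure P] (x : (n : ℕ) → Fin n → Ω → I) (hind : ∀ n, iIndepFun (x n) P)
    (hlaw : ∀ n i, HasLaw (x n i) (volume : Measure I) P) {δ : ℝ} (hδ : 0 < δ) :
    Tendsto (fun n => P {ω | ¬ FineBelow δ fun i => x n i ω}) atTop (𝓝 0) := by
  obtain ⟨M, hM⟩ := exists_nat_gt (2 / δ)
  have hM' : (0 : ℝ) < M := (by positivity : (0 : ℝ) < 2 / δ).trans hM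
  have hMδ : 2 / M ≤ δ := by
    rw [div_lt_iff₀ hδ] at hM
    rw [div_le_iff₀ hM']
    linarith
  have hsub (n : ℕ) : {ω | ¬ FineBelow δ fun i => x n i ω} ⊆
      ⋃ k ∈ Finset.range M, ⋂ i ∈ Finset.univ, x n i ⁻¹' (cell M k)ᶜ := by
    intro ω hω
    by_contra hcon
    refine hω (fineBelow_of_forall_cell (by exact_mod_cast hM') hMδ fun k hk => ?_)
    by_contra! hmiss
    exact hcon (Set.mem_biUnion (by simpa using hk) (by simpa using hmiss))
  have hmiss (n k : ℕ) : P (⋂ i ∈ Finset.univ, x n i ⁻¹' (cell M k)ᶜ) =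
      volume (cell M k)ᶜ ^ n := by
    rw [(hind n).measure_inter_preimage_eq_mul _ fun i _ => (measurableSet_cell M k).compl]
    have (i : Fin n) : P (x n i ⁻¹' (cell M k)ᶜ) = volume (cell M k)ᶜ := by
      rw [← Measure.map_apply_of_aemeasurable (hlaw n i).aemeasurable
        (measurableSet_cell M k).compl, (hlaw n i).map_eq]
    simp only [this, Finset.prod_const, Finset.card_univ, Fintype.card_fin]
  have hlim : Tendsto (fun n => ∑ k ∈ Finset.range M, volume (cell M k)ᶜ ^ n) atTop (𝓝 0) := by
    rw [← Finset.sum_const_zero (s := Finset.range M)]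
    refine tendsto_finsetSum _ fun k hk => ENNReal.tendsto_pow_atTop_nhds_zero_of_lt_one ?_
    rw [prob_compl_eq_one_sub (measurableSet_cell M k)]
    exact ENNReal.sub_lt_self ENNReal.one_ne_top one_ne_zero
      (volume_cell_pos (Finset.mem_range.1 hk)).ne'
  refine tendsto_of_tendsto_of_tendsto_of_le_of_le tendsto_const_nhds hlim
    (fun _ => zero_le) fun n => ?_
  calc P {ω | ¬ FineBelow δ fun i => x n i ω}
      ≤ P (⋃ k ∈ Finset.range M, ⋂ i ∈ Finset.univ, x n i ⁻¹' (cell M k)ᶜ) :=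
        measure_mono (hsub n)
    _ ≤ ∑ k ∈ Finset.range M, P (⋂ i ∈ Finset.univ, x n i ⁻¹' (cell M k)ᶜ) :=
        measure_biUnion_finset_le _ _
    _ = _ := by simp only [hmiss]

/-! ### Continuity from Lipschitz estimates -/

theorem continuous_of_abs_sub_le {W : I → I → ℝ} {A : ℝ}
    (hW : ∀ u₁ v₁ u₂ v₂ : I, |W u₂ v₂ - W u₁ v₁| ≤
      A * (|(u₂ : ℝ) - (u₁ : ℝ)| + |(v₂ : ℝ) - (v₁ : ℝ)|)) :
    Continuous (Function.uncurry W) := by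
  refine continuous_iff_continuousAt.2 fun p => tendsto_iff_dist_tendsto_zero.2 ?_
  refine squeeze_zero (g := fun q : I × I => A * (|(q.1 : ℝ) - p.1| + |(q.2 : ℝ) - p.2|))
    (fun _ => dist_nonneg) (fun q => hW _ _ _ _) ?_
  have hc : Continuous fun q : I × I => A * (|(q.1 : ℝ) - p.1| + |(q.2 : ℝ) - p.2|) := by
    fun_prop
  simpa using hc.tendsto p

theorem continuous_of_norm_sub_le {E : Type*} [SeminormedAddCommGroup E] {X : I → E} {A : ℝ}
    (hX : ∀ u v : I, ‖X u - X v‖ ≤ A * |(u : ℝ) - (v : ℝ)|) : Continuous X := by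
  refine continuous_iff_continuousAt.2 fun p => tendsto_iff_norm_sub_tendsto_zero.2 ?_
  refine squeeze_zero (fun _ => norm_nonneg _) (fun q => hX q p) ?_
  have hc : Continuous fun q : I => A * |(q : ℝ) - p| := by fun_prop
  simpa using hc.tendsto p

end CIGN

theorem mainTheorem3 {d m e : ℕ} (Φ : CIGN.Network (d + 1) m e) (W : CIGN.Graphon)
    (X : CIGN.I → EuclideanSpace ℝ (Fin d)) (A₁ A₂ A₃ : ℝ)
    (hW : ∀ u₁ v₁ u₂ v₂ : CIGN.I, |W.toFun u₂ v₂ - W.toFun u₁ v₁| ≤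
      A₁ * (|(u₂ : ℝ) - (u₁ : ℝ)| + |(v₂ : ℝ) - (v₁ : ℝ)|))
    (hfilter : Φ.FilterBound A₂)
    (hX : ∀ u v : CIGN.I, ‖X u - X v‖ ≤ A₃ * |(u : ℝ) - (v : ℝ)|)
    (hσ : Φ.NormalizedLipschitz)
    (full : Bool) :
    Tendsto (fun n : ℕ => CIGN.error full Φ W X (CIGN.fixedGrid n)) atTop (𝓝 0) ∧
    ∀ {Ω : Type*} [MeasurableSpace Ω] (P : Measure Ω) [IsProbabilityMeasure P]
      (x : (n : ℕ) → Fin n → Ω → CIGN.I),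
      (∀ n, iIndepFun (x n) P) →
      (∀ n i, HasLaw (x n i) (volume : Measure CIGN.I) P) →
      ∀ ε : ℝ≥0∞, 0 < ε →
        Tendsto (fun n : ℕ =>
          P {ω | ε ≤ CIGN.error full Φ W X (CIGN.sorted fun i => x n i ω)}) atTop (𝓝 0) := by
  have hWc := CIGN.continuous_of_abs_sub_le hW
  have hXc := CIGN.continuous_of_norm_sub_le hX
  refine ⟨?_, fun P _ x hind hlaw ε hε => ?_⟩
  · refine ENNReal.tendsto_nhds_zero.2 fun ε hε => ?_
    obtain ⟨δ, hδ, h⟩ := CIGN.exists_forall_fineBelow_error_lt full Φ hσ W hWc hXc hε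
    filter_upwards [tendsto_natCast_atTop_atTop.eventually_gt_atTop (1 / δ)] with n hn
    exact (h n _ (CIGN.monotone_fixedGrid n) (CIGN.fineBelow_fixedGrid hδ hn)).le
  · obtain ⟨δ, hδ, h⟩ := CIGN.exists_forall_fineBelow_error_lt full Φ hσ W hWc hXc hε
    refine tendsto_of_tendsto_of_tendsto_of_le_of_le tendsto_const_nhds
      (CIGN.tendsto_measure_not_fineBelow P x hind hlaw hδ) (fun _ => zero_le)
      fun n => measure_mono fun ω (hω : ε ≤ _) hfine => ?_
    exact hω.not_gt (h n _ (Tuple.monotone_sort _) hfine.sorted)
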